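/- Let $\Gamma$ be a finite connected topological graph (a finite connected $1$-dimensional cell complex) with at least one edge. A \emph{topological graph-map} $f\colon\Gamma\to\Gamma$ is a continuous map sending vertices to vertices such that for every oriented edge $e$, with characteristic map $j\colon[a,b]\to\Gamma$, the map $f\circ j$ is either constant at a vertex or there are a subdivision $a=c_0<c_1<\dots<c_n=b$ with $n\ge 1$ and oriented edges $e_1,\dots,e_n$ such that $t(e_i)=o(e_{i+1})$ for $1\le i<n$ and, for each $i$, $f\circ j$ sends $c_{i-1}$ and $c_i$ to the initial vertex $o(e_i)$ and the terminal vertex $t(e_i)$ of $e_i$ and maps $(c_{i-1},c_i)$ by an orientation-preserving homeomorphism onto the open edge $e_i$; write $f(e)=e_1\cdots e_n$ (with $f(e)$ of length $0$ in the constant case). The map $f$ is \emph{regular} if for every oriented edge $e$ the path $f(e)$ has positive length and contains no subpath of the form $e'e'^{-1}$. Choose an orientation of each topological edge and an enumeration $e_1,\dots,e_k$ of the positively oriented edges; the \emph{transition matrix} $A(f)$ is the $k\times k$ matrix whose $(i,j)$ entry is the number of occurrences of $e_j^{\pm1}$ in $f(e_i)$. Let $\lambda(f)$ be the spectral radius of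 $A(f)$ (the largest modulus of a complex eigenvalue). Then for every regular topological graph-map $f\colon\Gamma\to\Gamma$, the topological entropy $h(f)$ of $f$ satisfies $$h(f)=\log\lambda(f).$$ (Neither irreducibility of $A(f)$ nor any expansion of $f$ is assumed; $f$ may be the identity on nondegenerate subintervals of edges.) -/

import Mathlib

open Set Topology

noncomputable section

namespace TopGraph

/-- An oriented edge of a `1`-dimensional CW complex `X`: a topological edge (a `1`-cell) together
with one of its two orientations. `(i, true)` carries the orientation of the characteristic map
of the cell `i`, and `(i, false)` the opposite one. -/
abbrev OrientedEdge (X : Type*) [TopologicalSpace X] [CWComplex (univ : Set X)] : Type _ :=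
  RelCWComplex.cell (univ : Set X) 1 × Bool

section

variable {X : Type*} [TopologicalSpace X] [CWComplex (univ : Set X)]

/-- The set of vertices: the union of the `0`-cells. -/
def vertexSet (X : Type*) [TopologicalSpace X] [CWComplex (univ : Set X)] : Set X :=
  ⋃ i : RelCWComplex.cell (univ : Set X) 0, RelCWComplex.openCell 0 i

namespace OrientedEdge

/-- The inverse edge `e⁻¹`: the same topological edge with the opposite orientation. -/
def inv (e : OrientedEdge X) : OrientedEdge X := (e.1, !e.2)

/-- The characteristic map `[-1, 1] → X` of an oriented edge. (Values outside `[-1, 1]` are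
irrelevant.) -/
def char (e : OrientedEdge X) (t : ℝ) : X :=
  RelCWComplex.map (C := (univ : Set X)) 1 e.1 (fun _ => if e.2 then t else -t)

/-- The initial vertex of an oriented edge. -/
def origin (e : OrientedEdge X) : X := e.char (-1)

/-- The terminal vertex of an oriented edge. -/
def terminus (e : OrientedEdge X) : X := e.char 1

end OrientedEdge

/-- The restriction of `g` to the open interval `(c, d)` is an orientation-preserving homeomorphism
onto the open `1`-cell of the oriented edge `e`: it is the characteristic map of `e`, which on
`(-1, 1)` is a homeomorphism onto that cell, precomposed with an order isomorphism
`(c, d) ≃ (-1, 1)` (equivalently, an increasing homeomorphism of these open intervals). -/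
def IsOrientedHomeoOnto (g : ℝ → X) (c d : ℝ) (e : OrientedEdge X) : Prop :=
  ∃ φ : Ioo c d ≃o Ioo (-1 : ℝ) 1, ∀ t : Ioo c d, g t = e.char (φ t)

/-- A list of oriented edges is a combinatorial edge-path if consecutive edges match up. The empty
list stands for the degenerate paths (of simplicial length `0`). -/
def IsEdgePath (γ : List (OrientedEdge X)) : Prop :=
  γ.IsChain fun e e' => e.terminus = e'.origin

/-- A combinatorial edge-path is tight if it has no subpath of the form `e e⁻¹`. -/
def IsTight (γ : List (OrientedEdge X)) : Prop :=
  γ.IsChain fun e e' => e' ≠ e.inv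

/-- `g : [a, b] → X` is a topological edge-path with associated combinatorial edge-path `γ`. Either
`γ` is degenerate and `g` is constant at a vertex, or there is a subdivision
`a = c₀ < c₁ < ⋯ < cₙ = b`, with `n` the length of `γ`, such that `g` maps each `(cᵢ, cᵢ₊₁)` by an
orientation-preserving homeomorphism onto the `i`-th edge of `γ`. -/
def IsTopologicalEdgePath (g : ℝ → X) (a b : ℝ) (γ : List (OrientedEdge X)) : Prop :=
  ContinuousOn g (Icc a b) ∧ IsEdgePath γ ∧
    ((γ = [] ∧ ∃ v ∈ vertexSet X, ∀ s ∈ Icc a b, g s = v) ∨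
      (γ ≠ [] ∧ ∃ c : Fin (γ.length + 1) → ℝ, StrictMono c ∧ c 0 = a ∧ c (Fin.last _) = b ∧
        ∀ i : Fin γ.length,
          g (c i.castSucc) = (γ.get i).origin ∧ g (c i.succ) = (γ.get i).terminus ∧
            IsOrientedHomeoOnto g (c i.castSucc) (c i.succ) (γ.get i)))

end

/-- A topological graph-map `f : X → Y`: a continuous map sending vertices to vertices, such that
for each oriented edge `e` the composition of `f` with the characteristic map of `e` is a (possibly
degenerate) topological edge-path. The associated combinatorial edge-path, which is determined by
`f`, is recorded as `f.path e`. -/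
structure GraphMap (X Y : Type*) [TopologicalSpace X] [CWComplex (univ : Set X)]
    [TopologicalSpace Y] [CWComplex (univ : Set Y)] where
  toFun : X → Y
  continuous_toFun : Continuous toFun
  mapsTo_vertexSet : MapsTo toFun (vertexSet X) (vertexSet Y)
  path : OrientedEdge X → List (OrientedEdge Y)
  isTopologicalEdgePath : ∀ e : OrientedEdge X,
    IsTopologicalEdgePath (fun t => toFun (e.char t)) (-1) 1 (path e)

namespace GraphMap

variable {X Y : Type*} [TopologicalSpace X] [CWComplex (univ : Set X)]
  [TopologicalSpace Y] [CWComplex (univ : Set Y)]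

/-- A topological graph-map is regular if the edge-path of each oriented edge is nondegenerate and
tight. -/
def IsRegular (f : GraphMap X Y) : Prop :=
  ∀ e : OrientedEdge X, f.path e ≠ [] ∧ IsTight (f.path e)

/-- The transition matrix of a topological graph-map `f : X → X` with respect to a choice `σ` of
an orientation for each topological edge: the entry `(i, j)` is the number of occurrences of the
`j`-th edge, with either orientation, in the edge-path `f.path eᵢ` of the `i`-th positively
oriented edge `eᵢ = (i, σ i)`. -/
def transitionMatrix [DecidableEq (RelCWComplex.cell (univ : Set X) 1)] (f : GraphMap X X)
    (σ : RelCWComplex.cell (univ : Set X) 1 → Bool) :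
    Matrix (RelCWComplex.cell (univ : Set X) 1) (RelCWComplex.cell (univ : Set X) 1) ℕ :=
  fun i j => (f.path (i, σ i)).countP fun e => e.1 = j

end GraphMap

end TopGraph

end

/-! The subdivision points cut every edge into laps, each mapped homeomorphically onto an open edge,
so entry `(i, j)` of `A ^ m` counts the laps of `f^[m]` in edge `i` that cover edge `j`. Both
inequalities come from counting these laps; no expansion is needed.

Upper bound: fix an entourage and cut the edges finely enough for it. Pulling these cuts back along
inverse branches for `n` steps leaves pieces whose points stay close up to time `n`. Their number is
controlled by `∑ k < n, A ^ k`, hence by a multiple of `r ^ n` for every `r > λ` (`exists_cutSets`,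
`exists_isDynCoverOf`). Here `λ ≥ 1`, since every edge has a lap.

Lower bound: the trace of `A ^ m` is at least `λ ^ m / 2` in norm for infinitely many `m`, so if `1
< r < λ`, some diagonal entry of some `A ^ m` exceeds `r ^ m` by at least 2. Thus many laps of
`f^[m]` in one edge cover that edge. After discarding the two extreme ones, the others form a
horseshoe of disjoint compact arcs over a compact arc (`log_pow_apply_sub_two_le`), and a horseshoe
with `q` legs for `f^[m]` forces entropy at least `(log q) / m` (`log_card_le_mul_coverEntropy`). -/

namespace TopGraph

/-! ### Spectral radius, matrix powers and traces -/

section LinearAlgebra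

open Filter

/-- On a generalized eigenspace the map is `μ` plus a commuting nilpotent, so each further factor
multiplies the trace by `μ`. -/
theorem trace_pow_eq_sum_finrank {V : Type*} [AddCommGroup V] [Module ℂ V] [FiniteDimensional ℂ V]
    (f : Module.End ℂ V) :
    ∃ s : Finset ℂ, (∀ μ, f.HasEigenvalue μ → μ ∈ s) ∧ ∀ m : ℕ, LinearMap.trace ℂ V (f ^ m) =
      ∑ μ ∈ s, (Module.finrank ℂ (f.maxGenEigenspace μ) : ℂ) * μ ^ m := by
  have hfin : {μ | f.maxGenEigenspace μ ≠ ⊥}.Finite :=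
    WellFoundedGT.finite_ne_bot_of_iSupIndep f.independent_maxGenEigenspace
  refine ⟨hfin.toFinset, fun μ hμ => ?_, fun m => ?_⟩
  · rw [Set.Finite.mem_toFinset, mem_ofPred_eq]
    intro h
    refine hμ ?_
    rw [eq_bot_iff, ← h]
    exact (f.genEigenspace μ).monotone le_top
  · have hint : DirectSum.IsInternal fun μ => f.maxGenEigenspace μ :=
      DirectSum.isInternal_submodule_of_iSupIndep_of_iSup_eq_top f.independent_maxGenEigenspace
        f.iSup_maxGenEigenspace_eq_top
    have hmaps : ∀ μ, MapsTo (f ^ m) (f.maxGenEigenspace μ) (f.maxGenEigenspace μ) := fun μ =>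
      f.mapsTo_maxGenEigenspace_of_comm (Commute.pow_right (Commute.refl f) m) μ
    rw [LinearMap.trace_eq_sum_trace_restrict' hint hfin hmaps]
    refine Finset.sum_congr rfl fun μ _ => ?_
    have hmf := f.mapsTo_maxGenEigenspace_of_comm (Commute.refl f) μ
    have hr : (f ^ m).restrict (hmaps μ) = (f.restrict hmf) ^ m :=
      (Module.End.pow_restrict m hmf).symm
    set g := f.restrict hmf with hg
    have hnil : IsNilpotent (g - algebraMap ℂ _ μ) := by
      convert f.isNilpotent_restrict_maxGenEigenspace_sub_algebraMap μ using 1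
      ext x
      rfl
    rw [hr]
    clear hr hmaps
    induction m with
    | zero => simp
    | succ m ih =>
      rw [pow_succ, Module.End.mul_eq_comp,
        LinearMap.trace_comp_eq_mul_of_commute_of_isNilpotent μ
          (Commute.pow_left (Commute.refl g) m) hnil, ih]
      ring

variable {J : Type*} [Fintype J] [DecidableEq J]

theorem spectralRadius_ne_top [Nonempty J] (A : Matrix J J ℂ) : spectralRadius ℂ A ≠ ⊤ := by
  let := Matrix.linftyOpNormedRing (n := J) (α := ℂ)
  let := Matrix.linftyOpNormedAlgebra (n := J) (α := ℂ) (R := ℂ)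
  have : CompleteSpace (Matrix J J ℂ) := FiniteDimensional.complete ℂ _
  obtain ⟨μ, -, hr⟩ := spectrum.exists_nnnorm_eq_spectralRadius A
  exact hr ▸ ENNReal.coe_ne_top

/-- Gelfand's formula for the `ℓ^∞` operator norm, which is the largest row sum; `C` absorbs the
finitely many powers below the threshold. -/
theorem exists_sum_norm_pow_le_of_spectralRadius_lt (A : Matrix J J ℂ) {r : ℝ}
    (hr : spectralRadius ℂ A < ENNReal.ofReal r) :
    ∃ C : ℝ, 0 ≤ C ∧ ∀ m i, ∑ j, ‖(A ^ m) i j‖ ≤ C * r ^ m := by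
  let := Matrix.linftyOpNormedRing (n := J) (α := ℂ)
  let := Matrix.linftyOpNormedAlgebra (n := J) (α := ℂ) (R := ℂ)
  have : CompleteSpace (Matrix J J ℂ) := FiniteDimensional.complete ℂ _
  have hr0 : 0 < r := ENNReal.ofReal_pos.1 (bot_le.trans_lt hr)
  have hev := (spectrum.pow_norm_pow_one_div_tendsto_nhds_spectralRadius A).eventually_lt_const hr
  obtain ⟨N, hN⟩ := eventually_atTop.1 (hev.and (eventually_ge_atTop 1))
  have hrow : ∀ m i, ∑ j, ‖(A ^ m) i j‖ ≤ ‖A ^ m‖ := by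
    intro m i
    rw [Matrix.linfty_opNorm_def]
    have := Finset.le_sup (f := fun i => ∑ j, ‖(A ^ m) i j‖₊) (Finset.mem_univ i)
    refine le_trans (le_of_eq ?_) (NNReal.coe_le_coe.2 this)
    push_cast
    rfl
  have hbig : ∀ m, N ≤ m → ‖A ^ m‖ ≤ r ^ m := by
    intro m hm
    obtain ⟨h1, h2⟩ := hN m hm
    rw [ENNReal.ofReal_lt_ofReal_iff hr0] at h1
    have h3 := pow_le_pow_left₀ (by positivity) h1.le m
    rwa [← Real.rpow_natCast, ← Real.rpow_mul (norm_nonneg _), one_div,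
      inv_mul_cancel₀ (by positivity), Real.rpow_one] at h3
  refine ⟨1 + ∑ m ∈ Finset.range N, ‖A ^ m‖ / r ^ m, by positivity, fun m i => (hrow m i).trans ?_⟩
  have hp : 0 < r ^ m := by positivity
  rcases le_or_gt N m with h | h
  · refine (hbig m h).trans (le_mul_of_one_le_left hp.le ?_)
    exact le_add_of_nonneg_right (by positivity)
  · rw [← div_le_iff₀ hp]
    refine le_trans ?_ (le_add_of_nonneg_left zero_le_one)
    exact Finset.single_le_sum (f := fun m => ‖A ^ m‖ / r ^ m) (fun _ _ => by positivity)
      (Finset.mem_range.2 h)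

/-- Eigenvalue contributions may cancel for particular `m`. Recurrence of rotations of a finite
torus brings all arguments of `μ ^ m` near 0 simultaneously for infinitely many `m`; every term then
has real part at least half its modulus, and nothing cancels. -/
theorem frequently_spectralRadius_pow_le_trace [Nonempty J] (A : Matrix J J ℂ) :
    ∃ᶠ m : ℕ in atTop, (spectralRadius ℂ A).toReal ^ m ≤ 2 * ‖(A ^ m).trace‖ := by
  let := Matrix.linftyOpNormedRing (n := J) (α := ℂ)
  let := Matrix.linftyOpNormedAlgebra (n := J) (α := ℂ) (R := ℂ)
  have : CompleteSpace (Matrix J J ℂ) := FiniteDimensional.complete ℂ _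
  obtain ⟨μ₀, hμ₀, hr⟩ := spectrum.exists_nnnorm_eq_spectralRadius A
  have hr' : (spectralRadius ℂ A).toReal = ‖μ₀‖ := by rw [← hr]; simp
  let T : Module.End ℂ (J → ℂ) := Matrix.toLin' A
  obtain ⟨s, hs, htr⟩ := trace_pow_eq_sum_finrank T
  have hev : T.HasEigenvalue μ₀ := by
    rw [Module.End.hasEigenvalue_iff_mem_spectrum, show T = Matrix.toLin' A from rfl,
      Matrix.spectrum_toLin']
    exact hμ₀
  have hfreq := (mapClusterPt_one_atTop_pow (fun μ : s => Circle.exp (Complex.arg μ))).frequently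
    (p := fun y : s → Circle => ∀ i, 1 / 2 < ((y i : ℂ)).re) (by
      rw [eventually_all]
      intro i
      have hc : Continuous fun y : s → Circle => ((y i : ℂ)).re := by fun_prop
      refine hc.continuousAt.eventually (lt_mem_nhds ?_)
      norm_num)
  refine hfreq.mono fun m hm => ?_
  have hre : ∀ μ : s, ‖(μ : ℂ)‖ ^ m / 2 ≤ ((μ : ℂ) ^ m).re := by
    intro μ
    have h1 := hm μ
    have h2 : (μ : ℂ) ^ m =
        ((‖(μ : ℂ)‖ ^ m : ℝ) : ℂ) * ((Circle.exp (Complex.arg μ) ^ m : Circle) : ℂ) := by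
      conv_lhs => rw [← Complex.norm_mul_exp_arg_mul_I (μ : ℂ)]
      rw [mul_pow]
      push_cast
      simp
    rw [h2, Complex.re_ofReal_mul]
    have : 0 ≤ ‖(μ : ℂ)‖ ^ m := by positivity
    simp only [Pi.pow_apply] at h1
    nlinarith
  have htrace : (A ^ m).trace =
      ∑ μ ∈ s, (Module.finrank ℂ (T.maxGenEigenspace μ) : ℂ) * μ ^ m := by
    rw [← htr, show T = Matrix.toLin' A from rfl, ← Matrix.toLin'_pow, Matrix.trace_toLin'_eq]
  have hpos : 1 ≤ Module.finrank ℂ (T.maxGenEigenspace μ₀) := by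
    rw [Nat.one_le_iff_ne_zero, Ne, Submodule.finrank_eq_zero]
    intro h
    refine hev ?_
    rw [eq_bot_iff, ← h]
    exact (T.genEigenspace μ₀).monotone le_top
  have hle : ‖μ₀‖ ^ m / 2 ≤ ((A ^ m).trace).re := by
    rw [htrace, Complex.re_sum]
    have hterm : ∀ μ ∈ s,
        0 ≤ ((Module.finrank ℂ (T.maxGenEigenspace μ) : ℂ) * μ ^ m).re := by
      intro μ hμ
      rw [← Complex.ofReal_natCast, Complex.re_ofReal_mul]
      have := hre ⟨μ, hμ⟩
      exact mul_nonneg (by positivity) (le_trans (by positivity) this)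
    refine le_trans ?_ (Finset.single_le_sum hterm (hs μ₀ hev))
    rw [← Complex.ofReal_natCast, Complex.re_ofReal_mul]
    have h1 := hre ⟨μ₀, hs μ₀ hev⟩
    have h2 : (0:ℝ) ≤ ‖μ₀‖ ^ m := by positivity
    have h3 : (1:ℝ) ≤ (Module.finrank ℂ (T.maxGenEigenspace μ₀) : ℝ) := by
      exact_mod_cast hpos
    simp only at h1
    nlinarith
  rw [hr']
  linarith [Complex.re_le_norm (A ^ m).trace]

end LinearAlgebra

/-! ### Entropy bounds from covers and from horseshoes -/

section Entropy

open Dynamics Uniformity UniformSpace ExpGrowth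
open scoped ENNReal

/-- Any itinerary is realized by pulling back: a point following the tail lies in `P`, hence has a
preimage under `T^[m]` in the first leg. -/
theorem exists_orbit_of_subset_image {X ι : Type*} {T : X → X} {P : Set X} (hP : P.Nonempty)
    {L : ι → Set X} {m : ℕ} (hLP : ∀ w, L w ⊆ P) (hPL : ∀ w, P ⊆ T^[m] '' L w) (n : ℕ) (w : Fin n → ι) :
    ∃ x ∈ P, ∀ k : Fin n, T^[m * k] x ∈ L (w k) := by
  induction n with
  | zero => exact ⟨_, hP.some_mem, fun k => k.elim0⟩
  | succ n ih =>
    obtain ⟨y, hy, hyL⟩ := ih (Fin.tail w)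
    obtain ⟨x, hx, rfl⟩ := hPL (w 0) hy
    refine ⟨x, hLP _ hx, Fin.cases (by simpa using hx) fun k => ?_⟩
    have := hyL k
    rwa [← Function.iterate_add_apply] at this

variable {X : Type*} [UniformSpace X] {T : X → X}

theorem coverEntropy_le_log_of_card_le {b : ℝ≥0∞}
    (h : ∀ U ∈ 𝓤 X, ∃ C : ℝ≥0∞, C ≠ ∞ ∧ ∀ n, ∃ s : Finset X,
      IsDynCoverOf T univ U n s ∧ (s.card : ℝ≥0∞) ≤ C * b ^ n) :
    coverEntropy T univ ≤ ENNReal.log b := by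
  refine iSup₂_le fun U hU => ?_
  obtain ⟨C, hC, hs⟩ := h U hU
  rw [← expGrowthSup_pow]
  refine expGrowthSup_le_of_eventually_le hC (Filter.Eventually.of_forall fun n => ?_)
  obtain ⟨s, hcov, hcard⟩ := hs n
  refine le_trans ?_ hcard
  exact_mod_cast ENat.toENNReal_le.2 hcov.coverMincard_le_card

/-- Disjoint compact legs are separated by one entourage, so the `q ^ n` itineraries of length `n`
yield points with disjoint dynamical balls at time `m * n`. -/
theorem log_card_le_mul_coverEntropy [T2Space X] {ι : Type*} [Fintype ι] {P : Set X}
    (hP : P.Nonempty) {L : ι → Set X} {m : ℕ} (hm : m ≠ 0) (hL : ∀ w, IsCompact (L w))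
    (hdisj : Pairwise fun w w' => Disjoint (L w) (L w'))
    (hLP : ∀ w, L w ⊆ P) (hPL : ∀ w, P ⊆ T^[m] '' L w) :
    ENNReal.log (Fintype.card ι : ℝ≥0∞) ≤ m * coverEntropy T univ := by
  classical
  have hV : ∀ p : ι × ι, ∃ V ∈ 𝓤 X, p.1 ≠ p.2 →
      Disjoint (⋃ x ∈ L p.1, ball x V) (⋃ x ∈ L p.2, ball x V) := by
    intro p
    by_cases hp : p.1 = p.2
    · exact ⟨univ, Filter.univ_mem, fun h => (h hp).elim⟩
    · obtain ⟨V, hV, hd⟩ :=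
        (hdisj hp).exists_uniform_thickening (hL p.1) (hL p.2).isClosed
      exact ⟨V, hV, fun _ => hd⟩
  choose V hVu hVd using hV
  set U := ⋂ p, V p with hU
  have hUu : U ∈ 𝓤 X := Filter.iInter_mem.2 hVu
  have hbound : ∀ n, ((Fintype.card ι : ℝ≥0∞)) ^ n ≤ (netMaxcard T univ U (m * n) : ℝ≥0∞) := by
    intro n
    choose x hxP hx using exists_orbit_of_subset_image hP hLP hPL n
    have hsep : ∀ w w', w ≠ w' → Disjoint (ball (x w) (dynEntourage T U (m * n)))
        (ball (x w') (dynEntourage T U (m * n))) := by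
      intro w w' hne
      obtain ⟨k, hk⟩ := Function.ne_iff.1 hne
      rw [Set.disjoint_left]
      intro z hz hz'
      have hlt : m * k < m * n := Nat.mul_lt_mul_of_pos_left k.2 (Nat.pos_of_ne_zero hm)
      have h1 := mem_ball_dynEntourage.1 hz _ hlt
      have h2 := mem_ball_dynEntourage.1 hz' _ hlt
      exact Set.disjoint_left.1 (hVd (w k, w' k) hk)
        (mem_iUnion₂.2 ⟨_, hx w k, ball_mono (iInter_subset V (w k, w' k)) _ h1⟩)
        (mem_iUnion₂.2 ⟨_, hx w' k, ball_mono (iInter_subset V (w k, w' k)) _ h2⟩)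
    have hrefl : ∀ w, x w ∈ ball (x w) (dynEntourage T U (m * n)) := fun w =>
      mem_ball_dynEntourage.2 fun k _ => mem_ball_self _ hUu
    have hinj : Function.Injective x := by
      intro w w' hww
      by_contra hne
      exact Set.disjoint_left.1 (hsep w w' hne) (hrefl w) (hww ▸ hrefl w')
    have hnet : IsDynNetIn T univ U (m * n) (Finset.univ.image x : Finset X) := by
      refine ⟨subset_univ _, ?_⟩
      rintro _ ha _ hb hab
      simp only [Finset.coe_image, Finset.coe_univ, image_univ, mem_range] at ha hb
      obtain ⟨w, rfl⟩ := ha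
      obtain ⟨w', rfl⟩ := hb
      exact hsep w w' fun h => hab (h ▸ rfl)
    have hc := hnet.card_le_netMaxcard
    rw [Finset.card_image_of_injective _ hinj, Finset.card_univ, Fintype.card_fun,
      Fintype.card_fin] at hc
    exact_mod_cast ENat.toENNReal_le.2 hc
  have hmono : Monotone fun n => ((netMaxcard T univ U n : ℕ∞) : ℝ≥0∞) := fun _ _ h =>
    ENat.toENNReal_le.2 (netMaxcard_monotone_time T univ U h)
  calc ENNReal.log (Fintype.card ι : ℝ≥0∞)
      = expGrowthSup fun n => (Fintype.card ι : ℝ≥0∞) ^ n := expGrowthSup_pow.symm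
    _ ≤ expGrowthSup fun n => ((netMaxcard T univ U (m * n) : ℕ∞) : ℝ≥0∞) :=
        expGrowthSup_monotone hbound
    _ = m * netEntropyEntourage T univ U := hmono.expGrowthSup_comp_mul hm
    _ ≤ m * coverEntropy T univ := by
        gcongr
        exact netEntropyEntourage_le_coverEntropy T univ hUu

end Entropy

/-! ### Inverse branches between arcs -/

section Branches

/-- `θ` maps `(-1, 1)` into itself, continuously and strictly monotonically, and is a branch of the
inverse of `f` from the arc parametrized by `h` to the arc parametrized by `g`. -/
structure IsInverseBranch {X : Type*} (f : X → X) (g h : ℝ → X) (θ : ℝ → ℝ) : Prop where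
  mapsTo : MapsTo θ (Ioo (-1) 1) (Ioo (-1) 1)
  continuousOn : ContinuousOn θ (Ioo (-1) 1)
  strictMonoOn_or_strictAntiOn : StrictMonoOn θ (Ioo (-1) 1) ∨ StrictAntiOn θ (Ioo (-1) 1)
  apply_apply : ∀ s ∈ Ioo (-1 : ℝ) 1, f (g (θ s)) = h s

namespace IsInverseBranch

variable {X : Type*} {f f' : X → X} {g h k : ℝ → X} {θ θ' : ℝ → ℝ}

theorem id (g : ℝ → X) : IsInverseBranch id g g id :=
  ⟨mapsTo_id _, continuousOn_id, .inl strictMonoOn_id, fun _ _ => rfl⟩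

theorem comp (hθ : IsInverseBranch f g h θ) (hθ' : IsInverseBranch f' h k θ') :
    IsInverseBranch (f' ∘ f) g k (θ ∘ θ') where
  mapsTo := hθ.mapsTo.comp hθ'.mapsTo
  continuousOn := hθ.continuousOn.comp hθ'.continuousOn hθ'.mapsTo
  strictMonoOn_or_strictAntiOn := by
    rcases hθ.strictMonoOn_or_strictAntiOn with h1 | h1 <;>
      rcases hθ'.strictMonoOn_or_strictAntiOn with h2 | h2
    · exact .inl (h1.comp h2 hθ'.mapsTo)
    · exact .inr (h1.comp_strictAntiOn h2 hθ'.mapsTo)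
    · exact .inr (h1.comp_strictMonoOn h2 hθ'.mapsTo)
    · exact .inl (h1.comp h2 hθ'.mapsTo)
  apply_apply s hs := by
    simp only [Function.comp_apply]
    rw [hθ.apply_apply _ (hθ'.mapsTo hs), hθ'.apply_apply s hs]

theorem injOn (hθ : IsInverseBranch f g h θ) : InjOn θ (Ioo (-1) 1) :=
  hθ.strictMonoOn_or_strictAntiOn.elim StrictMonoOn.injOn StrictAntiOn.injOn

theorem mapsTo_uIcc (hθ : IsInverseBranch f g h θ) {s t : ℝ} (hs : s ∈ Ioo (-1 : ℝ) 1)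
    (ht : t ∈ Ioo (-1 : ℝ) 1) : MapsTo θ (uIcc s t) (uIcc (θ s) (θ t)) := by
  have hsub : uIcc s t ⊆ Ioo (-1) 1 := ordConnected_Ioo.uIcc_subset hs ht
  rcases hθ.strictMonoOn_or_strictAntiOn with h1 | h1
  · exact (h1.monotoneOn.mono hsub).mapsTo_uIcc
  · exact (h1.antitoneOn.mono hsub).mapsTo_uIcc

theorem ordConnected_image (hθ : IsInverseBranch f g h θ) : OrdConnected (θ '' Ioo (-1) 1) :=
  (isPreconnected_Ioo.image θ hθ.continuousOn).ordConnected

end IsInverseBranch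

end Branches

/-! ### Cutting an interval by finitely many points -/

section Intervals

open scoped Uniformity

theorem exists_finset_forall_disjoint_uIcc_mem {X : Type*} [UniformSpace X] {g : ℝ → X}
    (hg : ContinuousOn g (Icc (-1) 1)) {U : Set (X × X)} (hU : U ∈ 𝓤 X) :
    ∃ s : Finset ℝ, ∀ x ∈ Ioo (-1 : ℝ) 1, ∀ y ∈ Ioo (-1 : ℝ) 1,
      Disjoint (uIcc x y) (s : Set ℝ) → (g x, g y) ∈ U := by
  have hu := isCompact_Icc.uniformContinuousOn_of_continuous hg hU
  rw [Filter.mem_map, Filter.mem_inf_principal, Metric.mem_uniformity_dist] at hu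
  obtain ⟨δ, hδ, hsub⟩ := hu
  -- A grid of mesh `δ` starting at `-1`: points of `(-1, 1)` at distance at least `δ` have a grid
  -- point between them, of index at most `⌈2 / δ⌉₊`.
  refine ⟨(Finset.range (⌈2 / δ⌉₊ + 2)).image fun k : ℕ => -1 + k * δ, fun x hx y hy hd => ?_⟩
  refine hsub (a := x) (b := y) ?_ ⟨Ioo_subset_Icc_self hx, Ioo_subset_Icc_self hy⟩
  by_contra hxy
  wlog hle : x ≤ y generalizing x y
  · exact this y hy x hx (by rwa [uIcc_comm]) (by rwa [dist_comm]) (le_of_not_ge hle)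
  rw [Real.dist_eq, abs_sub_comm, abs_of_nonneg (sub_nonneg.2 hle), not_lt] at hxy
  have h0 : 0 ≤ (x + 1) / δ := div_nonneg (by linarith [hx.1]) hδ.le
  have h1 := Nat.le_ceil ((x + 1) / δ)
  have h2 := Nat.ceil_lt_add_one h0
  rw [div_le_iff₀ hδ] at h1
  have h3 : (⌈(x + 1) / δ⌉₊ : ℝ) * δ < x + 1 + δ := by
    calc _ < ((x + 1) / δ + 1) * δ := by gcongr
      _ = _ := by field_simp
  have h4 : ⌈(x + 1) / δ⌉₊ ≤ ⌈2 / δ⌉₊ := Nat.ceil_le_ceil (by gcongr; linarith [hx.2])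
  have hz : -1 + (⌈(x + 1) / δ⌉₊ : ℝ) * δ ∈ uIcc x y := by
    rw [uIcc_of_le hle]
    constructor <;> linarith
  exact Set.disjoint_left.1 hd hz
    (Finset.mem_coe.2 (Finset.mem_image.2 ⟨_, Finset.mem_range.2 (by omega), rfl⟩))

theorem exists_finset_representatives (I : Set ℝ) (F : Finset ℝ) :
    ∃ Q : Finset ℝ, ↑Q ⊆ I ∧ Q.card ≤ 2 * F.card + 1 ∧
      ∀ x ∈ I, ∃ q ∈ Q, x = q ∨ Disjoint (uIcc x q) (F : Set ℝ) := by
  classical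
  -- `c` labels the position relative to `F`: even values are the gaps, odd values the points of
  -- `F`, hence `2 * F.card + 1` labels.
  let c : ℝ → ℕ := fun x => (F.filter (· < x)).card + (F.filter (· ≤ x)).card
  have hc : ∀ x y, x < y → c x = c y → Disjoint (Icc x y) (F : Set ℝ) := by
    intro x y hxy h
    have h1 : F.filter (· < x) ⊆ F.filter (· < y) :=
      Finset.monotone_filter_right _ fun z _ (hz : z < x) => hz.trans hxy
    have h2 : F.filter (· ≤ x) ⊆ F.filter (· ≤ y) :=
      Finset.monotone_filter_right _ fun z _ (hz : z ≤ x) => hz.trans hxy.le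
    have h1' := Finset.card_le_card h1
    have h2' := Finset.card_le_card h2
    have e1 := Finset.eq_of_subset_of_card_le h1 (by simp only [c] at h; omega)
    have e2 := Finset.eq_of_subset_of_card_le h2 (by simp only [c] at h; omega)
    rw [Set.disjoint_left]
    intro z hz hzF
    rcases hz.2.lt_or_eq with hlt | rfl
    · have : z ∈ F.filter (· < x) := e1 ▸ Finset.mem_filter.2 ⟨hzF, hlt⟩
      exact absurd (Finset.mem_filter.1 this).2 (not_lt.2 hz.1)
    · have : z ∈ F.filter (· ≤ x) := e2 ▸ Finset.mem_filter.2 ⟨hzF, le_rfl⟩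
      exact absurd (Finset.mem_filter.1 this).2 (not_le.2 hxy)
  obtain ⟨Q, hQI, hQ⟩ := exists_subset_bijOn I c
  have hmaps : MapsTo c Q (Finset.range (2 * F.card + 1)) := fun x _ => by
    have h1 := Finset.card_filter_le F (· < x)
    have h2 := Finset.card_filter_le F (· ≤ x)
    rw [Finset.mem_coe, Finset.mem_range]
    simp only [c]
    omega
  have hfin : Q.Finite := Set.Finite.of_injOn hmaps hQ.injOn (Finset.finite_toSet _)
  refine ⟨hfin.toFinset, by simpa using hQI, ?_, fun x hx => ?_⟩
  · have := Finset.card_le_card_of_injOn (s := hfin.toFinset)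
      (t := Finset.range (2 * F.card + 1)) c (by simpa using hmaps)
      (by simpa using hQ.injOn)
    simpa using this
  · obtain ⟨q, hq, hqx⟩ := hQ.surjOn (mem_image_of_mem c hx)
    refine ⟨q, by simpa using hq, ?_⟩
    rcases lt_trichotomy x q with h | h | h
    · exact .inr (by rw [uIcc_of_le h.le]; exact hc x q h hqx.symm)
    · exact .inl h
    · exact .inr (by rw [uIcc_of_ge h.le]; exact hc q x h hqx)

end Intervals

/-- A self-map `f` of a space carrying finitely many parametrized arcs `g i`, each of which is cut
into finitely many laps: the `k`-th lap of `g i` is mapped by `f` onto the arc `g (target i k)`,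
and `branch i k` is the corresponding inverse branch. -/
structure LapSystem {X J : Type*} (f : X → X) (g : J → ℝ → X) where
  numLaps : J → ℕ
  target : ∀ i, Fin (numLaps i) → J
  branch : ∀ i, Fin (numLaps i) → ℝ → ℝ
  cuts : J → Finset ℝ
  isInverseBranch : ∀ i k, IsInverseBranch f (g i) (g (target i k)) (branch i k)
  disjoint_branch : ∀ i, Pairwise fun k l =>
    Disjoint (branch i k '' Ioo (-1) 1) (branch i l '' Ioo (-1) 1)
  exists_mem_branch : ∀ i, ∀ x ∈ Ioo (-1 : ℝ) 1, ∀ y ∈ Ioo (-1 : ℝ) 1,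
    Disjoint (uIcc x y) (cuts i : Set ℝ) →
      ∃ k, x ∈ branch i k '' Ioo (-1) 1 ∧ y ∈ branch i k '' Ioo (-1) 1

/-! ### Counting laps: dynamical covers and horseshoes -/

namespace LapSystem

variable {X J : Type*} [Fintype J] [DecidableEq J] {f : X → X} {g : J → ℝ → X}
  (S : LapSystem f g)

/-- The entry `(i, j)` is the number of laps of the arc `i` that are mapped onto the arc `j`. -/
def matrix : Matrix J J ℕ := fun i j => (Finset.univ.filter fun k => S.target i k = j).card

theorem sum_target (i : J) (x : J → ℕ) : ∑ k, x (S.target i k) = ∑ j, S.matrix i j * x j := by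
  rw [← Finset.sum_fiberwise (s := Finset.univ) (g := S.target i)]
  refine Finset.sum_congr rfl fun j _ => ?_
  rw [Finset.sum_congr rfl fun k hk => by rw [(Finset.mem_filter.1 hk).2], Finset.sum_const,
    smul_eq_mul, matrix]

open Dynamics in
theorem exists_cutSets {U : Set (X × X)} (s : J → Finset ℝ)
    (hs : ∀ i, ∀ x ∈ Ioo (-1 : ℝ) 1, ∀ y ∈ Ioo (-1 : ℝ) 1,
      Disjoint (uIcc x y) (s i : Set ℝ) → (g i x, g i y) ∈ U) (n : ℕ) :
    ∃ F : J → Finset ℝ,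
      (∀ i, (F i).card ≤ ∑ k ∈ Finset.range n,
        (S.matrix ^ k).mulVec (fun j => (s j).card + (S.cuts j).card) i) ∧
      ∀ i, ∀ x ∈ Ioo (-1 : ℝ) 1, ∀ y ∈ Ioo (-1 : ℝ) 1, Disjoint (uIcc x y) (F i : Set ℝ) →
        (g i x, g i y) ∈ dynEntourage f U n := by
  set b : J → ℕ := fun j => (s j).card + (S.cuts j).card with hb
  induction n with
  | zero => exact ⟨fun _ => ∅, by simp, by simp⟩
  | succ n ih =>
    obtain ⟨F, hFcard, hF⟩ := ih
    -- A segment avoiding the cuts lies in one lap; avoiding the pulled-back sets as well, its image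
    -- avoids the set for time `n` on the target arc.
    refine ⟨fun i => (s i ∪ S.cuts i) ∪ Finset.univ.biUnion fun k =>
      (F (S.target i k)).image (S.branch i k), fun i => ?_, fun i x hx y hy hd => ?_⟩
    · have h1 : (Finset.univ.biUnion fun k => (F (S.target i k)).image (S.branch i k)).card ≤
          ∑ k, (F (S.target i k)).card :=
        Finset.card_biUnion_le.trans (Finset.sum_le_sum fun k _ => Finset.card_image_le)
      rw [S.sum_target i fun j => (F j).card] at h1
      have h2 : ∑ j, S.matrix i j * (F j).card ≤
          ∑ k ∈ Finset.range n, (S.matrix ^ (k + 1)).mulVec b i := by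
        calc _ ≤ ∑ j, S.matrix i j * ∑ k ∈ Finset.range n, (S.matrix ^ k).mulVec b j := by
              gcongr with j
              exact hFcard j
          _ = ∑ k ∈ Finset.range n, (S.matrix ^ (k + 1)).mulVec b i := by
              simp_rw [Finset.mul_sum]
              rw [Finset.sum_comm]
              refine Finset.sum_congr rfl fun k _ => ?_
              rw [pow_succ', ← Matrix.mulVec_mulVec]
              rfl
      rw [Finset.sum_range_succ']
      refine (Finset.card_union_le _ _).trans ?_
      rw [add_comm]
      refine add_le_add (h1.trans h2) ((Finset.card_union_le _ _).trans ?_)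
      simp [hb]
    · rw [Finset.coe_union, Finset.coe_union, disjoint_union_right, disjoint_union_right] at hd
      obtain ⟨⟨hds, hdc⟩, hdF⟩ := hd
      rw [mem_dynEntourage]
      obtain ⟨k, ⟨u, hu, rfl⟩, ⟨v, hv, rfl⟩⟩ := S.exists_mem_branch i x hx y hy hdc
      have hθ := S.isInverseBranch i k
      have hmem := hF (S.target i k) u hu v hv (by
        rw [Set.disjoint_left]
        intro z hz hzF
        refine Set.disjoint_left.1 hdF (hθ.mapsTo_uIcc hu hv hz) ?_
        exact Finset.mem_coe.2 (Finset.mem_biUnion.2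
          ⟨k, Finset.mem_univ k, Finset.mem_image_of_mem _ hzF⟩))
      rw [mem_dynEntourage] at hmem
      rintro (_ | l) hl
      · exact hs i _ hx _ hy hds
      · rw [Function.iterate_succ_apply, Function.iterate_succ_apply, hθ.apply_apply u hu,
          hθ.apply_apply v hv]
        exact hmem l (by omega)

open Dynamics Uniformity in
theorem exists_isDynCoverOf [UniformSpace X] (hg : ∀ i, ContinuousOn (g i) (Icc (-1) 1))
    {V : Set X} (hV : V.Finite) (hcov : ∀ x, x ∈ V ∨ ∃ i, x ∈ g i '' Ioo (-1) 1)
    {U : Set (X × X)} (hU : U ∈ 𝓤 X) :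
    ∃ (b : J → ℕ) (c : ℕ), ∀ n, ∃ s : Finset X, IsDynCoverOf f univ U n s ∧
      s.card ≤ c + 2 * ∑ k ∈ Finset.range n, ∑ i, (S.matrix ^ k).mulVec b i := by
  classical
  choose s hs using fun i => exists_finset_forall_disjoint_uIcc_mem (hg i) hU
  refine ⟨fun j => (s j).card + (S.cuts j).card, hV.toFinset.card + Fintype.card J, fun n => ?_⟩
  obtain ⟨F, hFcard, hF⟩ := S.exists_cutSets s hs n
  choose Q hQI hQcard hQ using fun i => exists_finset_representatives (Ioo (-1) 1) (F i)
  have hrefl : ∀ x, (x, x) ∈ dynEntourage f U n := fun x =>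
    mem_dynEntourage.2 fun k _ => refl_mem_uniformity hU
  refine ⟨hV.toFinset ∪ Finset.univ.biUnion fun i => (Q i).image (g i), ?_, ?_⟩
  · intro x _
    rcases hcov x with hx | ⟨i, t, ht, rfl⟩
    · exact ⟨x, by simp [hx], hrefl x⟩
    · obtain ⟨q, hq, hqt⟩ := hQ i t ht
      refine ⟨g i q, ?_, ?_⟩
      · refine Finset.mem_coe.2 (Finset.mem_union_right _ (Finset.mem_biUnion.2
          ⟨i, Finset.mem_univ i, Finset.mem_image_of_mem _ hq⟩))
      · rcases hqt with rfl | hd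
        · exact hrefl _
        · exact hF i t ht q (hQI i hq) hd
  · refine (Finset.card_union_le _ _).trans ?_
    rw [add_assoc]
    refine Nat.add_le_add_left ?_ _
    calc _ ≤ ∑ i, ((Q i).image (g i)).card := Finset.card_biUnion_le
      _ ≤ ∑ i, (2 * (∑ k ∈ Finset.range n, (S.matrix ^ k).mulVec
            (fun j => (s j).card + (S.cuts j).card) i) + 1) := by
          refine Finset.sum_le_sum fun i _ => Finset.card_image_le.trans ((hQcard i).trans ?_)
          have := hFcard i
          omega
      _ = _ := by
          rw [Finset.sum_add_distrib, ← Finset.mul_sum, Finset.sum_comm]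
          simp [add_comm]

/-- Branches of `f^[m + 1]` are a branch of `f` composed with a branch of `f^[m]`. Their images are
disjoint because the first laps differ, or else by injectivity of the common first branch. -/
theorem exists_iterate_branches (m : ℕ) (i : J) :
    ∃ (ι : Type) (_ : Fintype ι) (τ : ι → J) (θ : ι → ℝ → ℝ),
      (∀ j, (Finset.univ.filter fun w => τ w = j).card = (S.matrix ^ m) i j) ∧
      (∀ w, IsInverseBranch f^[m] (g i) (g (τ w)) (θ w)) ∧
      Pairwise fun w w' => Disjoint (θ w '' Ioo (-1) 1) (θ w' '' Ioo (-1) 1) := by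
  induction m generalizing i with
  | zero =>
    refine ⟨Unit, inferInstance, fun _ => i, fun _ => id, fun j => ?_,
      fun _ => IsInverseBranch.id _, fun w w' h => (h rfl).elim⟩
    rcases eq_or_ne i j with rfl | hij
    · simp
    · simp [hij]
  | succ m ih =>
    choose ι hι τ θ hcard hbr hdisj using ih
    refine ⟨Σ k, ι (S.target i k), inferInstance, fun w => τ _ w.2,
      fun w => S.branch i w.1 ∘ θ _ w.2, fun j => ?_, fun w => ?_, ?_⟩
    · rw [pow_succ', Matrix.mul_apply, ← S.sum_target i fun l => (S.matrix ^ m) l j]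
      simp_rw [← hcard]
      rw [← Finset.card_sigma]
      congr 1
      ext w
      simp
    · rw [Function.iterate_succ]
      exact (S.isInverseBranch i w.1).comp (hbr _ w.2)
    · rintro ⟨k, w⟩ ⟨k', w'⟩ hne
      simp only [image_comp]
      rcases eq_or_ne k k' with rfl | hk
      · have hw : w ≠ w' := fun h => hne (h ▸ rfl)
        exact (hdisj _ hw).image (S.isInverseBranch i k).injOn
          (hbr _ w).mapsTo.image_subset (hbr _ w').mapsTo.image_subset
      · exact (S.disjoint_branch i hk).mono (image_mono (hbr _ w).mapsTo.image_subset)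
          (image_mono (hbr _ w').mapsTo.image_subset)

open Dynamics in
-- Open laps need not contain the closure of anything invariant, so the arc is shrunk to the compact
-- interval between the extreme values of `θ w 0`. Natural subtraction is harmless, as `log 0 = ⊥`.
theorem log_pow_apply_sub_two_le [UniformSpace X] [T2Space X] {i : J}
    (hg : ContinuousOn (g i) (Icc (-1) 1)) (hinj : InjOn (g i) (Ioo (-1) 1)) {m : ℕ} (hm : m ≠ 0) :
    ENNReal.log (((S.matrix ^ m) i i - 2 : ℕ) : ENNReal) ≤ m * coverEntropy f univ := by
  classical
  obtain ⟨ι, _, τ, θ, hcard, hbr, hdisj⟩ := S.exists_iterate_branches m i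
  set W := Finset.univ.filter fun w => τ w = i with hW
  rw [← hcard i, ← hW]
  rcases W.eq_empty_or_nonempty with hem | hne
  · simp [hem]
  have h0 : (0 : ℝ) ∈ Ioo (-1 : ℝ) 1 := by norm_num
  have hbr' : ∀ w ∈ W, IsInverseBranch f^[m] (g i) (g i) (θ w) := fun w hw => by
    have := hbr w
    rwa [(Finset.mem_filter.1 hw).2] at this
  obtain ⟨wa, hwa, hmin⟩ := W.exists_min_image (fun w => θ w 0) hne
  obtain ⟨wb, hwb, hmax⟩ := W.exists_max_image (fun w => θ w 0) hne
  set a := θ wa 0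
  set b := θ wb 0
  have hab : a ≤ b := hmin wb hwb
  have ha : a ∈ Ioo (-1 : ℝ) 1 := (hbr' wa hwa).mapsTo h0
  have hb : b ∈ Ioo (-1 : ℝ) 1 := (hbr' wb hwb).mapsTo h0
  have hK : Icc a b ⊆ Ioo (-1 : ℝ) 1 := fun x hx => ⟨ha.1.trans_le hx.1, hx.2.trans_lt hb.2⟩
  set E := (W.erase wa).erase wb with hE
  have hEW : ∀ w ∈ E, w ∈ W := fun w hw => Finset.mem_of_mem_erase (Finset.mem_of_mem_erase hw)
  have hcardE : W.card - 2 ≤ Fintype.card E := by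
    rw [Fintype.card_coe, hE]
    have h1 := Finset.pred_card_le_card_erase (s := W) (a := wa)
    have h2 := Finset.pred_card_le_card_erase (s := W.erase wa) (a := wb)
    omega
  refine le_trans (ENNReal.log_monotone (Nat.cast_le.2 hcardE)) ?_
  -- The image of a remaining branch is an interval meeting `[a, b]` at `θ w 0` and missing `a` and
  -- `b`, which lie in the images of other branches; it cannot leave `[a, b]`.
  have hinK : ∀ w ∈ E, MapsTo (θ w) (Icc a b) (Icc a b) := by
    intro w hw s hs
    have hwW := hEW w hw
    have hord := (hbr' w hwW).ordConnected_image
    have hwb' : w ≠ wb := (Finset.mem_erase.1 hw).1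
    have hwa' : w ≠ wa := (Finset.mem_erase.1 (Finset.mem_of_mem_erase hw)).1
    have hna : a ∉ θ w '' Ioo (-1) 1 := fun h =>
      Set.disjoint_left.1 (hdisj hwa') h (mem_image_of_mem _ h0)
    have hnb : b ∉ θ w '' Ioo (-1) 1 := fun h =>
      Set.disjoint_left.1 (hdisj hwb') h (mem_image_of_mem _ h0)
    have hmem := mem_image_of_mem (θ w) (hK hs)
    have hmem0 := mem_image_of_mem (θ w) h0
    constructor
    · by_contra! hlt
      exact hna (hord.out hmem hmem0 ⟨hlt.le, hmin w hwW⟩)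
    · by_contra! hlt
      exact hnb (hord.out hmem0 hmem ⟨hmax w hwW, hlt.le⟩)
  refine log_card_le_mul_coverEntropy (P := g i '' Icc a b) (L := fun w : E =>
    g i '' (θ w '' Icc a b)) ((nonempty_Icc.2 hab).image _) hm (fun w => ?_) ?_ (fun w => ?_)
    fun w => ?_
  · refine (isCompact_Icc.image_of_continuousOn
      ((hbr' w (hEW w w.2)).continuousOn.mono hK)).image_of_continuousOn (hg.mono ?_)
    exact (hinK w w.2).image_subset.trans (hK.trans Ioo_subset_Icc_self)
  · intro w w' hne'
    exact ((hdisj fun h => hne' (Subtype.ext h)).mono (image_mono hK) (image_mono hK)).image hinj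
      ((hinK w w.2).image_subset.trans hK) ((hinK w' w'.2).image_subset.trans hK)
  · exact image_mono (hinK w w.2).image_subset
  · rintro _ ⟨s, hs, rfl⟩
    exact ⟨_, mem_image_of_mem _ (mem_image_of_mem _ hs),
      (hbr' w (hEW w w.2)).apply_apply s (hK hs)⟩

end LapSystem

/-! ### Characteristic maps of edges and their inverse branches -/

section Characteristic

theorem isInverseBranch_neg {X : Type*} (g : ℝ → X) :
    IsInverseBranch id g (fun t => g (-t)) Neg.neg where
  mapsTo t ht := ⟨by linarith [ht.2], by linarith [ht.1]⟩
  continuousOn := continuous_neg.continuousOn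
  strictMonoOn_or_strictAntiOn := .inr fun _ _ _ _ h => neg_lt_neg h
  apply_apply _ _ := rfl

variable {X : Type*} [TopologicalSpace X] [CWComplex (univ : Set X)]

namespace OrientedEdge

theorem char_not (j : RelCWComplex.cell (univ : Set X) 1) (b : Bool) (t : ℝ) :
    char (j, !b) t = char (j, b) (-t) := by
  cases b <;> simp [char]

theorem continuousOn_char (e : OrientedEdge X) : ContinuousOn e.char (Icc (-1) 1) := by
  refine (RelCWComplex.continuousOn (C := univ) 1 e.1).comp
    (f := fun (t : ℝ) (_ : Fin 1) => if e.2 then t else -t) ?_ ?_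
  · refine Continuous.continuousOn (continuous_pi fun _ => ?_)
    cases e.2 <;> simp <;> fun_prop
  · intro t ht
    rw [mem_closedBall_zero_iff, pi_norm_le_iff_of_nonneg zero_le_one]
    intro _
    rw [Real.norm_eq_abs, abs_le]
    cases e.2 <;> simp <;> constructor <;> linarith [ht.1, ht.2]

theorem coord_mem_ball (b : Bool) {t : ℝ} (ht : t ∈ Ioo (-1 : ℝ) 1) :
    (fun _ : Fin 1 => if b then t else -t) ∈ Metric.ball (0 : Fin 1 → ℝ) 1 := by
  rw [mem_ball_zero_iff, pi_norm_lt_iff zero_lt_one]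
  intro _
  rw [Real.norm_eq_abs, abs_lt]
  cases b <;> simp <;> constructor <;> linarith [ht.1, ht.2]

theorem injOn_char (e : OrientedEdge X) : InjOn e.char (Ioo (-1) 1) := by
  intro s hs t ht h
  have hinj := (RelCWComplex.map (C := (univ : Set X)) 1 e.1).injOn
  rw [RelCWComplex.source_eq] at hinj
  have := congr_fun (hinj (coord_mem_ball e.2 hs) (coord_mem_ball e.2 ht) h) 0
  cases hb : e.2 <;> simpa [hb] using this

theorem openCell_subset_image_char (e : OrientedEdge X) :
    RelCWComplex.openCell (C := (univ : Set X)) 1 e.1 ⊆ e.char '' Ioo (-1) 1 := by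
  rintro _ ⟨p, hp, rfl⟩
  rw [mem_ball_zero_iff, pi_norm_lt_iff zero_lt_one] at hp
  have h0 := hp 0
  rw [Real.norm_eq_abs, abs_lt] at h0
  refine ⟨if e.2 then p 0 else -p 0, ?_, ?_⟩
  · cases e.2 <;> simp <;> constructor <;> linarith
  · rw [char]
    congr 1
    ext k
    rw [Subsingleton.elim k 0]
    cases e.2 <;> simp

end OrientedEdge

theorem finite_vertexSet [RelCWComplex.Finite (univ : Set X)] : (vertexSet X).Finite := by
  have := RelCWComplex.finite_cells_of_finite (C := (univ : Set X))
  have : Finite (RelCWComplex.cell (univ : Set X) 0) :=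
    Finite.of_injective (fun i => (⟨0, i⟩ : Σ n, RelCWComplex.cell (univ : Set X) n))
      sigma_mk_injective
  refine finite_iUnion fun i => ?_
  rw [RelCWComplex.openCell_zero_eq_singleton]
  exact finite_singleton _

theorem mem_vertexSet_or_mem_image_char
    (hdim : ∀ n : ℕ, 2 ≤ n → IsEmpty (RelCWComplex.cell (univ : Set X) n))
    (σ : RelCWComplex.cell (univ : Set X) 1 → Bool) (x : X) :
    x ∈ vertexSet X ∨ ∃ i, x ∈ OrientedEdge.char (i, σ i) '' Ioo (-1) 1 := by
  have hx : x ∈ ⋃ (n : ℕ) (j : RelCWComplex.cell (univ : Set X) n), RelCWComplex.openCell n j := by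
    rw [CWComplex.iUnion_openCell_eq_complex]
    exact mem_univ x
  obtain ⟨n, j, hj⟩ := mem_iUnion₂.1 hx
  match n, j, hj with
  | 0, j, hj => exact .inl (mem_iUnion.2 ⟨j, hj⟩)
  | 1, j, hj => exact .inr ⟨j, OrientedEdge.openCell_subset_image_char (j, σ j) hj⟩
  | n + 2, j, _ => exact (hdim (n + 2) (by omega)).elim j

/-- The orientation `b` is free because the path may traverse an edge against the chosen
orientation; precomposing with negation then gives a decreasing branch. -/
theorem IsOrientedHomeoOnto.exists_isInverseBranch {f : X → X} {g : ℝ → X} {c d : ℝ}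
    {e : OrientedEdge X} (h : IsOrientedHomeoOnto (fun t => f (g t)) c d e) (hc : -1 ≤ c)
    (hd : d ≤ 1) (b : Bool) :
    ∃ θ : ℝ → ℝ, IsInverseBranch f g (OrientedEdge.char (e.1, b)) θ ∧
      θ '' Ioo (-1) 1 = Ioo c d := by
  obtain ⟨φ, hφ⟩ := h
  obtain ⟨θ, hθ, him⟩ : ∃ θ : ℝ → ℝ, IsInverseBranch f g e.char θ ∧ θ '' Ioo (-1) 1 = Ioo c d := by
    let θ : ℝ → ℝ := fun s => if hs : s ∈ Ioo (-1 : ℝ) 1 then φ.symm ⟨s, hs⟩ else 0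
    have hθ : ∀ s (hs : s ∈ Ioo (-1 : ℝ) 1), θ s = φ.symm ⟨s, hs⟩ := fun s hs => dif_pos hs
    have him : θ '' Ioo (-1) 1 = Ioo c d := by
      ext t
      constructor
      · rintro ⟨s, hs, rfl⟩
        rw [hθ s hs]
        exact (φ.symm ⟨s, hs⟩).2
      · intro ht
        refine ⟨φ ⟨t, ht⟩, (φ ⟨t, ht⟩).2, ?_⟩
        rw [hθ _ (φ ⟨t, ht⟩).2]
        simp
    refine ⟨θ, ⟨?_, ?_, .inl ?_, fun s hs => ?_⟩, him⟩
    · rw [mapsTo_iff_image_subset, him]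
      exact Ioo_subset_Ioo hc hd
    · rw [continuousOn_iff_continuous_domRestrict]
      have : (Ioo (-1 : ℝ) 1).domRestrict θ = fun s => (φ.symm s : ℝ) := by
        ext s
        exact hθ s s.2
      rw [this]
      exact continuous_subtype_val.comp φ.symm.continuous
    · intro s hs t ht hst
      rw [hθ s hs, hθ t ht]
      exact φ.symm.strictMono (show (⟨s, hs⟩ : Ioo (-1 : ℝ) 1) < ⟨t, ht⟩ from hst)
    · rw [hθ s hs]
      simpa using hφ (φ.symm ⟨s, hs⟩)
  rcases Bool.eq_or_eq_not b e.2 with rfl | rfl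
  · exact ⟨θ, hθ, him⟩
  · refine ⟨θ ∘ Neg.neg, ?_, ?_⟩
    · have := hθ.comp (isInverseBranch_neg e.char)
      rwa [Function.id_comp, ← funext fun t => OrientedEdge.char_not e.1 e.2 t] at this
    · rw [image_comp, ← him]
      simp

end Characteristic

/-! ### Subdivisions of an interval -/

section Subdivision

theorem exists_mem_Ioo_of_notMem_range {α : Type*} [LinearOrder α] {n : ℕ} {c : Fin (n + 1) → α}
    {x : α} (h0 : c 0 < x) (hlast : x < c (Fin.last n)) (hx : x ∉ range c) :
    ∃ k : Fin n, x ∈ Ioo (c k.castSucc) (c k.succ) := by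
  by_contra! h
  have hall : ∀ k : Fin (n + 1), c k < x := by
    intro k
    induction k using Fin.induction with
    | zero => exact h0
    | succ k ih =>
      refine lt_of_le_of_ne (le_of_not_gt fun hlt => h k ⟨ih, hlt⟩) fun heq => hx ⟨_, heq⟩
  exact (hall (Fin.last n)).not_gt hlast

theorem mem_Ioo_of_disjoint_uIcc {α : Type*} [LinearOrder α] {s : Set α} {c d x y : α}
    (hx : x ∈ Ioo c d) (hd : Disjoint (uIcc x y) s) (hcs : c ∈ s) (hds : d ∈ s) : y ∈ Ioo c d := by
  constructor
  · by_contra! h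
    exact Set.disjoint_left.1 hd (mem_uIcc_of_ge h hx.1.le) hcs
  · by_contra! h
    exact Set.disjoint_left.1 hd (mem_uIcc_of_le hx.2.le h) hds

theorem countP_eq_card_filter_get {α : Type*} (p : α → Bool) (l : List α) :
    l.countP p = (Finset.univ.filter fun k : Fin l.length => p (l.get k) = true).card := by
  induction l with
  | nil => rfl
  | cons a l ih =>
    rw [List.countP_cons, ih, add_comm]
    exact (Fin.card_filter_univ_succ' fun k => p ((a :: l).get k) = true).symm

end Subdivision

/-! ### The lap system of a graph-map -/

namespace GraphMap

variable {X : Type*} [TopologicalSpace X] [CWComplex (univ : Set X)]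

theorem exists_lapSystem [Fintype (RelCWComplex.cell (univ : Set X) 1)]
    [DecidableEq (RelCWComplex.cell (univ : Set X) 1)] (f : GraphMap X X) (hf : ∀ e, f.path e ≠ [])
    (σ : RelCWComplex.cell (univ : Set X) 1 → Bool) :
    ∃ S : LapSystem f.toFun fun i => OrientedEdge.char (i, σ i),
      (∀ i, S.numLaps i ≠ 0) ∧ S.matrix = f.transitionMatrix σ := by
  classical
  have hpath : ∀ i, ∃ c : Fin ((f.path (i, σ i)).length + 1) → ℝ, StrictMono c ∧ c 0 = -1 ∧
      c (Fin.last _) = 1 ∧ ∀ k, IsOrientedHomeoOnto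
        (fun t => f.toFun (OrientedEdge.char (i, σ i) t)) (c k.castSucc) (c k.succ)
          ((f.path (i, σ i)).get k) := by
    intro i
    obtain ⟨-, -, h | ⟨-, c, hc, h0, h1, h⟩⟩ := f.isTopologicalEdgePath (i, σ i)
    · exact (hf _ h.1).elim
    · exact ⟨c, hc, h0, h1, fun k => (h k).2.2⟩
  choose c hc h0 h1 hlap using hpath
  have hθ : ∀ i (k : Fin (f.path (i, σ i)).length), ∃ θ : ℝ → ℝ,
      IsInverseBranch f.toFun (OrientedEdge.char (i, σ i))
        (OrientedEdge.char (((f.path (i, σ i)).get k).1, σ ((f.path (i, σ i)).get k).1)) θ ∧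
      θ '' Ioo (-1) 1 = Ioo (c i k.castSucc) (c i k.succ) := fun i k =>
    (hlap i k).exists_isInverseBranch
      ((h0 i).symm.le.trans ((hc i).monotone (Fin.zero_le _)))
      (((hc i).monotone (Fin.le_last _)).trans (h1 i).le) _
  choose θ hθ him using hθ
  refine ⟨⟨fun i => (f.path (i, σ i)).length, fun i k => ((f.path (i, σ i)).get k).1, θ,
    fun i => Finset.univ.image (c i), hθ, ?_, ?_⟩,
    fun i h => hf _ (List.eq_nil_of_length_eq_zero h), ?_⟩
  · intro i
    refine (pairwise_disjoint_on _).2 ?_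
    intro k l hkl
    rw [him, him, Set.disjoint_left]
    intro x hx hx'
    have : c i k.succ ≤ c i l.castSucc := (hc i).monotone (by
      rw [Fin.le_def, Fin.val_succ, Fin.val_castSucc]
      exact hkl)
    exact absurd (hx.2.trans_le (this.trans hx'.1.le)) (lt_irrefl _)
  · intro i x hx y _ hd
    rw [Finset.coe_image, Finset.coe_univ, image_univ] at hd
    obtain ⟨k, hk⟩ := exists_mem_Ioo_of_notMem_range (c := c i) ((h0 i).trans_lt hx.1)
      (hx.2.trans_eq (h1 i).symm) (Set.disjoint_left.1 hd left_mem_uIcc)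
    refine ⟨k, ?_⟩
    rw [him]
    exact ⟨hk, mem_Ioo_of_disjoint_uIcc hk hd (mem_range_self _) (mem_range_self _)⟩
  · ext i j
    simp only [LapSystem.matrix, transitionMatrix]
    simpa using (countP_eq_card_filter_get (fun e => decide (e.1 = j)) (f.path (i, σ i))).symm

end GraphMap

/-! ### Entropy and spectral radius -/

namespace LapSystem

variable {X J : Type*} [Fintype J] [DecidableEq J] {f : X → X} {g : J → ℝ → X}
  (S : LapSystem f g)

/-- The matrix of a lap system, with complex entries. -/
noncomputable abbrev complexMatrix : Matrix J J ℂ := S.matrix.map (Nat.cast : ℕ → ℂ)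

theorem complexMatrix_pow_apply (m : ℕ) (i j : J) :
    (S.complexMatrix ^ m) i j = ((S.matrix ^ m) i j : ℂ) := by
  have := congr_fun (congr_fun (map_pow (Nat.castRingHom ℂ).mapMatrix S.matrix m) i) j
  exact this.symm

theorem sum_norm_complexMatrix_pow (m : ℕ) (i : J) :
    ∑ j, ‖(S.complexMatrix ^ m) i j‖ = ∑ j, ((S.matrix ^ m) i j : ℝ) := by
  simp [complexMatrix_pow_apply]

theorem one_le_sum_matrix_pow (hS : ∀ i, S.numLaps i ≠ 0) (m : ℕ) (i : J) :
    1 ≤ ∑ j, (S.matrix ^ m) i j := by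
  induction m generalizing i with
  | zero => simp [Matrix.one_apply]
  | succ m ih =>
    simp_rw [pow_succ', Matrix.mul_apply]
    rw [Finset.sum_comm]
    simp_rw [← Finset.mul_sum]
    rw [← S.sum_target i fun l => ∑ j, (S.matrix ^ m) l j]
    refine le_trans ?_ (Finset.sum_le_sum fun k _ => ih (S.target i k))
    simpa using Nat.one_le_iff_ne_zero.2 (hS i)

/-- Row sums of all powers are at least 1, whereas a radius below 1 would make them tend to 0. -/
theorem one_le_spectralRadius [Nonempty J] (hS : ∀ i, S.numLaps i ≠ 0) :
    1 ≤ spectralRadius ℂ S.complexMatrix := by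
  by_contra! hlt
  obtain ⟨r, hr0, hr, hr1⟩ := ENNReal.lt_iff_exists_real_btwn.1 hlt
  rw [ENNReal.ofReal_lt_one] at hr1
  obtain ⟨C, -, hC⟩ := exists_sum_norm_pow_le_of_spectralRadius_lt _ hr
  have ht : Filter.Tendsto (fun m : ℕ => C * r ^ m) Filter.atTop (𝓝 (C * 0)) :=
    (tendsto_pow_atTop_nhds_zero_of_lt_one hr0 hr1).const_mul C
  rw [mul_zero] at ht
  obtain ⟨m, hm⟩ := (ht.eventually_lt_const one_pos).exists
  obtain ⟨i⟩ := ‹Nonempty J›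
  have h1 := hC m i
  rw [sum_norm_complexMatrix_pow] at h1
  have h2 : (1 : ℝ) ≤ ∑ j, ((S.matrix ^ m) i j : ℝ) := by
    exact_mod_cast S.one_le_sum_matrix_pow hS m i
  linarith

open Dynamics Uniformity in
theorem coverEntropy_le_log_spectralRadius [Nonempty J] [UniformSpace X]
    (hS : ∀ i, S.numLaps i ≠ 0) (hg : ∀ i, ContinuousOn (g i) (Icc (-1) 1)) {V : Set X}
    (hV : V.Finite) (hcov : ∀ x, x ∈ V ∨ ∃ i, x ∈ g i '' Ioo (-1) 1) :
    coverEntropy f univ ≤ ENNReal.log (spectralRadius ℂ S.complexMatrix) := by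
  have hexp : (coverEntropy f univ).exp ≤ spectralRadius ℂ S.complexMatrix := by
    refine le_of_forall_gt_imp_ge_of_dense fun R hR => ?_
    obtain ⟨r, -, hr, hrR⟩ := ENNReal.lt_iff_exists_real_btwn.1 hR
    refine le_trans ?_ hrR.le
    rw [← ENNReal.log_le_log_iff, EReal.log_exp]
    have hr1 : 1 < r := by
      rw [← ENNReal.one_lt_ofReal]
      exact (S.one_le_spectralRadius hS).trans_lt hr
    obtain ⟨C, hC0, hC⟩ := exists_sum_norm_pow_le_of_spectralRadius_lt _ hr
    refine coverEntropy_le_log_of_card_le fun U hU => ?_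
    obtain ⟨b, c, hs⟩ := S.exists_isDynCoverOf hg hV hcov hU
    have hsum : ∀ k, ((∑ i, (S.matrix ^ k).mulVec b i : ℕ) : ℝ) ≤
        Fintype.card J * (∑ j, b j : ℕ) * C * r ^ k := by
      intro k
      push_cast
      calc ∑ i, ((S.matrix ^ k).mulVec b i : ℝ)
          ≤ ∑ i : J, (∑ j, (b j : ℝ)) * (C * r ^ k) := by
            refine Finset.sum_le_sum fun i _ => ?_
            have h1 := hC k i
            rw [sum_norm_complexMatrix_pow] at h1
            refine le_trans ?_ (mul_le_mul_of_nonneg_left h1 (by positivity))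
            simp only [Matrix.mulVec, dotProduct]
            push_cast
            rw [Finset.mul_sum]
            refine Finset.sum_le_sum fun j _ => ?_
            rw [mul_comm]
            gcongr
            exact Finset.single_le_sum (f := fun j => (b j : ℝ)) (fun _ _ => by positivity)
              (Finset.mem_univ j)
        _ = _ := by
            rw [Finset.sum_const, Finset.card_univ, nsmul_eq_mul]
            ring
    -- Since `r > 1`, the geometric sum is at most `r ^ n / (r - 1)` and the constant `c` at most `c
    -- * r ^ n`.
    set D := (c : ℝ) + 2 * (Fintype.card J * (∑ j, b j : ℕ) * C * (1 / (r - 1))) with hD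
    have hr1' : 0 < r - 1 := by linarith
    refine ⟨ENNReal.ofReal D, ENNReal.ofReal_ne_top, fun n => ?_⟩
    obtain ⟨s, hcover, hcard⟩ := hs n
    refine ⟨s, hcover, ?_⟩
    rw [← ENNReal.ofReal_pow (by linarith), ← ENNReal.ofReal_mul (by positivity),
      ← ENNReal.ofReal_natCast]
    refine ENNReal.ofReal_le_ofReal ?_
    have hrn : 1 ≤ r ^ n := one_le_pow₀ hr1.le
    have hgeom : ∑ k ∈ Finset.range n, r ^ k ≤ 1 / (r - 1) * r ^ n := by
      rw [geom_sum_eq hr1.ne', one_div, inv_mul_eq_div]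
      gcongr
      linarith
    calc (s.card : ℝ)
        ≤ c + 2 * ∑ k ∈ Finset.range n, ((∑ i, (S.matrix ^ k).mulVec b i : ℕ) : ℝ) := by
          exact_mod_cast hcard
      _ ≤ c * r ^ n + 2 * ∑ k ∈ Finset.range n, Fintype.card J * (∑ j, b j : ℕ) * C * r ^ k := by
          gcongr with k
          · exact le_mul_of_one_le_right (by positivity) hrn
          · exact hsum k
      _ ≤ c * r ^ n + 2 * (Fintype.card J * (∑ j, b j : ℕ) * C * (1 / (r - 1) * r ^ n)) := by
          rw [← Finset.mul_sum]
          gcongr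
      _ = D * r ^ n := by
          rw [hD]
          ring
  simpa using ENNReal.log_monotone hexp

theorem exists_pow_le_matrix_pow_apply [Nonempty J] {r : ℝ} (hr1 : 1 < r)
    (hr : ENNReal.ofReal r < spectralRadius ℂ S.complexMatrix) :
    ∃ m ≠ 0, ∃ i, r ^ m ≤ ((S.matrix ^ m) i i - 2 : ℕ) := by
  set L := (spectralRadius ℂ S.complexMatrix).toReal with hL
  have hrL : r < L := by
    rwa [hL, ← ENNReal.ofReal_lt_iff_lt_toReal (by linarith) (spectralRadius_ne_top _)]
  have hr0 : 0 < r := by linarith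
  -- If every diagonal entry minus 2 were below `r ^ m`, the entries would be below `3 * r ^ m`, and
  -- the trace bound would give `L ^ m < 6 * card J * r ^ m`.
  have hgrow := (tendsto_pow_atTop_atTop_of_one_lt ((one_lt_div hr0).2 hrL)).eventually_ge_atTop
    (6 * Fintype.card J : ℝ)
  obtain ⟨m, htr, hm6, hm1⟩ :=
    ((frequently_spectralRadius_pow_le_trace S.complexMatrix).and_eventually
      (hgrow.and (Filter.eventually_ge_atTop 1))).exists
  refine ⟨m, by omega, ?_⟩
  by_contra! hlt
  have hrm : 1 ≤ r ^ m := one_le_pow₀ hr1.le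
  have hentry : ∀ i, ((S.matrix ^ m) i i : ℝ) < 3 * r ^ m := by
    intro i
    have h1 := hlt i
    have h2 : ((S.matrix ^ m) i i : ℝ) ≤ ((S.matrix ^ m) i i - 2 : ℕ) + 2 := by
      have : (S.matrix ^ m) i i ≤ ((S.matrix ^ m) i i - 2) + 2 := by omega
      exact_mod_cast this
    linarith
  have htrace : ‖(S.complexMatrix ^ m).trace‖ < Fintype.card J * (3 * r ^ m) := by
    calc ‖(S.complexMatrix ^ m).trace‖ ≤ ∑ i, ((S.matrix ^ m) i i : ℝ) := by
          refine (norm_sum_le _ _).trans (le_of_eq ?_)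
          simp [complexMatrix_pow_apply]
      _ < ∑ i : J, 3 * r ^ m :=
          Finset.sum_lt_sum_of_nonempty Finset.univ_nonempty fun i _ => hentry i
      _ = _ := by simp
  rw [div_pow, le_div_iff₀ (by positivity)] at hm6
  linarith

open Dynamics in
theorem log_spectralRadius_le_coverEntropy [Nonempty J] [UniformSpace X] [T2Space X]
    (hg : ∀ i, ContinuousOn (g i) (Icc (-1) 1)) (hinj : ∀ i, InjOn (g i) (Ioo (-1) 1)) :
    ENNReal.log (spectralRadius ℂ S.complexMatrix) ≤ coverEntropy f univ := by
  have hexp : spectralRadius ℂ S.complexMatrix ≤ (coverEntropy f univ).exp := by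
    refine le_of_forall_lt_imp_le_of_dense fun R hR => ?_
    obtain ⟨r, -, hRr, hr⟩ := ENNReal.lt_iff_exists_real_btwn.1 hR
    refine hRr.le.trans ?_
    rw [← ENNReal.log_le_log_iff, EReal.log_exp]
    rcases le_or_gt r 1 with hr1 | hr1
    -- For `r ≤ 1` the logarithm is nonpositive, and nonnegativity of entropy suffices.
    · refine le_trans ?_ (coverEntropy_nonneg f ⟨g (Classical.arbitrary J) 0, mem_univ _⟩)
      rw [← ENNReal.log_one]
      exact ENNReal.log_monotone (ENNReal.ofReal_le_one.2 hr1)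
    · obtain ⟨m, hm, i, hi⟩ := S.exists_pow_le_matrix_pow_apply hr1 hr
      have h1 : (m : EReal) * ENNReal.log (ENNReal.ofReal r) ≤ m * coverEntropy f univ := by
        rw [← ENNReal.log_pow]
        refine le_trans (ENNReal.log_monotone ?_)
          (S.log_pow_apply_sub_two_le (hg i) (hinj i) hm)
        rw [← ENNReal.ofReal_pow (by linarith), ← ENNReal.ofReal_natCast]
        exact ENNReal.ofReal_le_ofReal hi
      have hm0 : (0 : EReal) < m := by exact_mod_cast Nat.pos_of_ne_zero hm
      rw [← EReal.div_le_iff_le_mul hm0 (EReal.natCast_ne_top m), ← EReal.mul_div,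
        EReal.mul_div_cancel (EReal.natCast_ne_bot m) (EReal.natCast_ne_top m) hm0.ne'] at h1
      exact h1
  simpa using ENNReal.log_monotone hexp

end LapSystem

end TopGraph

/-- The topological entropy of a regular topological graph-map of a finite connected topological
graph with at least one edge is the logarithm of the spectral radius of its transition matrix.
The uniform structure on `X` is the one, unique since `X` is compact, that induces its topology;
both sides are extended real numbers. -/
theorem mainTheorem10 {X : Type*} [UniformSpace X] [T2Space X] [ConnectedSpace X]
    [CWComplex (univ : Set X)] [RelCWComplex.Finite (univ : Set X)]
    (hdim : ∀ n : ℕ, 2 ≤ n → IsEmpty (RelCWComplex.cell (univ : Set X) n))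
    [Fintype (RelCWComplex.cell (univ : Set X) 1)] [DecidableEq (RelCWComplex.cell (univ : Set X) 1)]
    (hedge : Nonempty (RelCWComplex.cell (univ : Set X) 1))
    (f : TopGraph.GraphMap X X) (hf : f.IsRegular)
    (σ : RelCWComplex.cell (univ : Set X) 1 → Bool) :
    Dynamics.coverEntropy f.toFun univ =
      ENNReal.log (spectralRadius ℂ ((f.transitionMatrix σ).map (Nat.cast : ℕ → ℂ))) := by
  obtain ⟨S, hlaps, hS⟩ := f.exists_lapSystem (fun e => (hf e).1) σ
  rw [← hS]
  exact le_antisymm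
    (S.coverEntropy_le_log_spectralRadius hlaps (fun i => TopGraph.OrientedEdge.continuousOn_char _)
      TopGraph.finite_vertexSet (TopGraph.mem_vertexSet_or_mem_image_char hdim σ))
    (S.log_spectralRadius_le_coverEntropy (fun i => TopGraph.OrientedEdge.continuousOn_char _)
      fun i => TopGraph.OrientedEdge.injOn_char _)
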